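/- **Theorem 4.1 (Wasserstein space of probability kernels is Polish).** Let $(X,d)$ be a complete separable metric space with its Borel $\sigma$-algebra, let $(\Omega,\mathcal F,P)$ be a separable probability space (i.e. there is a countable family $\mathcal A\subset\mathcal F$ such that for every $A\in\mathcal F$ and $\varepsilon>0$ some $B\in\mathcal A$ satisfies $P(A\triangle B)<\varepsilon$), and let $p\in[1,\infty)$. A probability kernel $\mu$ from $\Omega$ to $X$ is a family $(\mu_\omega)_{\omega\in\Omega}$ of Borel probability measures on $X$ such that $\omega\mapsto\mu_\omega(B)$ is $\mathcal F$-measurable for every Borel set $B$. Let $\mathcal K_p(X)$ be the set of probability kernels $\mu$ from $\Omega$ to $X$ with $$\mathbb E\int_X d(x,x_0)^p\,\mu_\omega(dx)<\infty\quad\text{for some }x_0\in X,$$ where two kernels $\mu,\nu$ are identified if $\mu_\omega=\nu_\omega$ for $P$-almost every $\omega$. For $\mu,\nu\in\mathcal K_p(X)$ let $$\mathcal W_p(\mu,\nu)=\Big(\inf_{\pi\in\mathcal K(\mu,\nu)}\mathbb E\int_{X\times X}d(x,y)^p\,\pi_\omega(dx,dy)\Big)^{1/p},$$ where $\mathcal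 K(\mu,\nu)$ is the set of probability kernels $\pi$ from $\Omega$ to $X\times X$ such that, for every $\omega$, $\pi_\omega$ has first marginal $\mu_\omega$ and second marginal $\nu_\omega$. For Borel probability measures $m,n$ on $X$ let $W_p(m,n)=\big(\inf_\pi\int d(x,y)^p\,\pi(dx,dy)\big)^{1/p}\in[0,\infty]$ be the usual Wasserstein distance, the infimum being over the probability measures $\pi$ on $X\times X$ with marginals $m$ and $n$. Then, for all $\mu,\nu\in\mathcal K_p(X)$, the function $\omega\mapsto W_p(\mu_\omega,\nu_\omega)$ is $P$-almost everywhere equal to an $\mathcal F$-measurable function and $$\mathcal W_p(\mu,\nu)=\big(\mathbb E\,W_p(\mu_\omega,\nu_\omega)^p\big)^{1/p};$$ moreover $\mathcal W_p$ is a well-defined, finite metric on $\mathcal K_p(X)$, and $(\mathcal K_p(X),\mathcal W_p)$ is a complete separable metric space. -/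

import Mathlib

open MeasureTheory ProbabilityTheory
open scoped ENNReal

noncomputable section

/-- The set `Π(μ, ν)` of couplings of two measures on `X`: the probability measures on `X × X`
with first marginal `μ` and second marginal `ν`. -/
def measureCouplings {X : Type*} [MeasurableSpace X] (μ ν : Measure X) : Set (Measure (X × X)) :=
  {π | IsProbabilityMeasure π ∧ π.fst = μ ∧ π.snd = ν}

/-- The usual `p`-Wasserstein distance between two probability measures,
`W_p(μ, ν) = (inf_{π ∈ Π(μ, ν)} ∫ d(x, y)^p dπ(x, y))^(1/p)`, with values in `[0, ∞]`. -/
def measureWasserstein {X : Type*} [MeasurableSpace X] [PseudoEMetricSpace X]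
    (p : ℝ) (μ ν : Measure X) : ℝ≥0∞ :=
  (⨅ π ∈ measureCouplings μ ν, ∫⁻ z, edist z.1 z.2 ^ p ∂π) ^ (1 / p)

/-- The set `K(μ, ν)` of couplings of two kernels from `Ω` to `X`: the probability kernels from `Ω`
to `X × X` with marginal kernels `μ` and `ν` (for every `ω`). -/
def kernelCouplings {Ω X : Type*} [MeasurableSpace Ω] [MeasurableSpace X] (μ ν : Kernel Ω X) :
    Set (Kernel Ω (X × X)) :=
  {π | IsMarkovKernel π ∧ π.fst = μ ∧ π.snd = ν}

/-- The `p`-Wasserstein distance between two probability kernels,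
`(inf_{π ∈ K(μ, ν)} E ∫ d(x, y)^p dπ_ω(x, y))^(1/p)`, with values in `[0, ∞]`. -/
def kernelWasserstein {Ω X : Type*} [MeasurableSpace Ω] [MeasurableSpace X]
    [PseudoEMetricSpace X] (P : Measure Ω) (p : ℝ) (μ ν : Kernel Ω X) : ℝ≥0∞ :=
  (⨅ π ∈ kernelCouplings μ ν, ∫⁻ ω, ∫⁻ z, edist z.1 z.2 ^ p ∂(π ω) ∂P) ^ (1 / p)

/-- The probability kernels from `Ω` to `X` with finite `p`-th moment,
`E ∫ d(x, x₀)^p dμ_ω(x) < ∞` for some `x₀`. -/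
def MomentKernel {Ω : Type*} [MeasurableSpace Ω] (P : Measure Ω) (p : ℝ)
    (X : Type*) [MeasurableSpace X] [PseudoEMetricSpace X] : Type _ :=
  {μ : Kernel Ω X // IsMarkovKernel μ ∧
    ∃ x₀ : X, ∫⁻ ω, ∫⁻ x, edist x x₀ ^ p ∂(μ ω) ∂P < ∞}

/-- Two kernels are identified if `μ_ω = ν_ω` for `P`-almost every `ω`. -/
def momentKernelSetoid {Ω : Type*} [MeasurableSpace Ω] (P : Measure Ω) (p : ℝ)
    (X : Type*) [MeasurableSpace X] [PseudoEMetricSpace X] : Setoid (MomentKernel P p X) where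
  r μ ν := ∀ᵐ ω ∂P, μ.1 ω = ν.1 ω
  iseqv :=
    { refl := fun _ => Filter.Eventually.of_forall fun _ => rfl
      symm := fun h => h.mono fun _ hω => hω.symm
      trans := fun h₁ h₂ => h₁.mp (h₂.mono fun _ hω₂ hω₁ => hω₁.trans hω₂) }

/-- The space `K_p(X)` of probability kernels from `Ω` to `X` with finite `p`-th moment, up to
`P`-almost sure equality. -/
def KernelSpace {Ω : Type*} [MeasurableSpace Ω] (P : Measure Ω) (p : ℝ)
    (X : Type*) [MeasurableSpace X] [PseudoEMetricSpace X] : Type _ :=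
  Quotient (momentKernelSetoid P p X)

/-- The class in `K_p(X)` of a kernel with finite `p`-th moment. -/
def KernelSpace.mk {Ω : Type*} [MeasurableSpace Ω] {P : Measure Ω} {p : ℝ}
    {X : Type*} [MeasurableSpace X] [PseudoEMetricSpace X] (μ : MomentKernel P p X) :
    KernelSpace P p X :=
  Quotient.mk (momentKernelSetoid P p X) μ

end

set_option linter.unusedSectionVars false

/-! The engine is randomization: since `X` is Polish, every kernel `μ` is the law of `F (ω, U)` for
a jointly measurable `F` and a uniform variable `U`
(`Kernel.exists_measurable_map_eq_unitInterval`). Two functions driven by the same noise give a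
coupling of their laws, so passing to laws is 1-Lipschitz from `L^p` of the product space to
kernels, and questions about kernels become questions about `X`-valued functions.

Integral formula: one inequality is pointwise in `ω`. For the other, nearly optimal couplings must
be chosen measurably, and countability does this. `exists_seq_coupling` couples `μ_ω` and `ν_ω` to
laws from a fixed sequence, with measurable indices; couplings between members of the sequence may
be picked arbitrarily; `exists_kernelCouplings_trans` glues the three. The costs of such couplings
also converge to `W_p (μ_ω, ν_ω)`, which gives its a.e. measurability. The metric axioms then follow
from those of `W_p` and Minkowski's inequality.

Separability: the product of `P` with Lebesgue measure is separable, hence so is the corresponding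
`L^p` family of `X`-valued functions, and taking laws carries a dense sequence to a dense sequence.

Completeness: nearly optimal couplings of successive terms of a rapidly Cauchy sequence are realized
by one sequence of functions, a Markov chain driven by independent uniform noise. It converges in
`L^p`, and the law of its limit is the limit kernel. -/

/-- The `p`-th root of the `p`-cost of a transport plan. -/
noncomputable def transportCost {X : Type*} [MeasurableSpace X] [PseudoEMetricSpace X] (p : ℝ)
    (π : Measure (X × X)) : ℝ≥0∞ :=
  (∫⁻ z, edist z.1 z.2 ^ p ∂π) ^ (1 / p)

/-- The `L^p` distance of two functions with values in a metric space. -/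
noncomputable def lpEDist {Y X : Type*} [MeasurableSpace Y] [PseudoEMetricSpace X] (p : ℝ)
    (m : Measure Y) (f g : Y → X) : ℝ≥0∞ :=
  (∫⁻ y, edist (f y) (g y) ^ p ∂m) ^ (1 / p)

/-- The kernel sending `ω` to the law of `f (ω, ·)`. -/
noncomputable def lawKernel {Ω Y X : Type*} [MeasurableSpace Ω] [MeasurableSpace Y]
    [MeasurableSpace X] (m : Measure Y) (f : Ω × Y → X) : Kernel Ω X :=
  (Kernel.id ×ₖ Kernel.const Ω m).map f


/-! ### Kernels as laws of functions of `ω` and independent noise -/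

section LawKernel

variable {Ω Y X Z : Type*} [MeasurableSpace Ω] [MeasurableSpace Y] [MeasurableSpace X]
  [MeasurableSpace Z] (m : Measure Y) [IsProbabilityMeasure m]

theorem lawKernel_apply {f : Ω × Y → X} (hf : Measurable f) (ω : Ω) :
    lawKernel m f ω = m.map fun y => f (ω, y) := by
  rw [lawKernel, Kernel.map_apply _ hf, Kernel.prod_apply, Kernel.id_apply, Kernel.const_apply,
    Measure.dirac_prod, Measure.map_map hf (by fun_prop)]
  rfl

theorem isMarkovKernel_lawKernel {f : Ω × Y → X} (hf : Measurable f) :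
    IsMarkovKernel (lawKernel m f) := by
  rw [lawKernel]
  exact Kernel.IsMarkovKernel.map _ hf

theorem lintegral_lawKernel {f : Ω × Y → X} (hf : Measurable f) {φ : X → ℝ≥0∞}
    (hφ : Measurable φ) (ω : Ω) :
    ∫⁻ x, φ x ∂(lawKernel m f ω) = ∫⁻ y, φ (f (ω, y)) ∂m := by
  rw [lawKernel_apply m hf, lintegral_map hφ (by fun_prop)]

theorem lawKernel_prodMk_mem_kernelCouplings {f g : Ω × Y → X} (hf : Measurable f)
    (hg : Measurable g) :
    lawKernel m (fun z => (f z, g z)) ∈ kernelCouplings (lawKernel m f) (lawKernel m g) := by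
  refine ⟨isMarkovKernel_lawKernel m (hf.prodMk hg), ?_, ?_⟩
  · rw [lawKernel, Kernel.fst_map_prod _ hg]
    rfl
  · rw [lawKernel, Kernel.snd_map_prod _ hf]
    rfl

end LawKernel

/-! ### Elementary operations on couplings -/

section Couplings

variable {Ω X : Type*} [MeasurableSpace Ω] [MeasurableSpace X]

theorem mem_measureCouplings_of_mem_kernelCouplings {μ ν : Kernel Ω X}
    {π : Kernel Ω (X × X)} (h : π ∈ kernelCouplings μ ν) (ω : Ω) :
    π ω ∈ measureCouplings (μ ω) (ν ω) := by
  obtain ⟨h0, h1, h2⟩ := h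
  refine ⟨inferInstance, ?_, ?_⟩
  · rw [← h1, Kernel.fst_apply]; rfl
  · rw [← h2, Kernel.snd_apply]; rfl

theorem prod_mem_measureCouplings (μ ν : Measure X) [IsProbabilityMeasure μ]
    [IsProbabilityMeasure ν] : μ.prod ν ∈ measureCouplings μ ν :=
  ⟨inferInstance, by simp, by simp⟩

theorem const_mem_kernelCouplings {μ ν : Measure X} {π : Measure (X × X)}
    (h : π ∈ measureCouplings μ ν) :
    Kernel.const Ω π ∈ kernelCouplings (Kernel.const Ω μ) (Kernel.const Ω ν) := by
  obtain ⟨h0, h1, h2⟩ := h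
  refine ⟨inferInstance, ?_, ?_⟩
  · ext ω : 1; rw [Kernel.fst_apply]; exact h1
  · ext ω : 1; rw [Kernel.snd_apply]; exact h2

theorem swap_mem_measureCouplings {μ ν : Measure X} {π : Measure (X × X)}
    (h : π ∈ measureCouplings μ ν) : π.map Prod.swap ∈ measureCouplings ν μ := by
  obtain ⟨h0, h1, h2⟩ := h
  exact ⟨Measure.isProbabilityMeasure_map (by fun_prop), by simp [h2], by simp [h1]⟩

theorem swapRight_mem_kernelCouplings {μ ν : Kernel Ω X} {π : Kernel Ω (X × X)}
    (h : π ∈ kernelCouplings μ ν) : Kernel.swapRight π ∈ kernelCouplings ν μ := by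
  obtain ⟨h0, h1, h2⟩ := h
  exact ⟨inferInstance, by simp [h2], by simp [h1]⟩

end Couplings

/-! ### Transport costs and the Wasserstein distance of measures -/

section Cost

variable {Ω X : Type*} [MeasurableSpace Ω] [MeasurableSpace X] [MetricSpace X]
  [SecondCountableTopology X] [BorelSpace X] {p : ℝ}

theorem measurable_edist_rpow (p : ℝ) : Measurable fun z : X × X => edist z.1 z.2 ^ p :=
  (measurable_fst.edist measurable_snd).pow_const p

theorem transportCost_swap (π : Measure (X × X)) :
    transportCost p (π.map Prod.swap) = transportCost p π := by
  rw [transportCost, transportCost, lintegral_map (measurable_edist_rpow p) measurable_swap]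
  simp only [Prod.fst_swap, Prod.snd_swap, edist_comm]

theorem transportCost_map {Y : Type*} [MeasurableSpace Y] (m : Measure Y) {f g : Y → X}
    (hf : Measurable f) (hg : Measurable g) :
    transportCost p (m.map fun y => (f y, g y)) = lpEDist p m f g := by
  rw [transportCost, lpEDist, lintegral_map (measurable_edist_rpow p) (hf.prodMk hg)]

theorem lpEDist_triangle {Y : Type*} [MeasurableSpace Y] (m : Measure Y) (hp : 1 ≤ p)
    {f g h : Y → X} (hf : Measurable f) (hg : Measurable g) (hh : Measurable h) :
    lpEDist p m f h ≤ lpEDist p m f g + lpEDist p m g h := by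
  have hp0 : 0 ≤ p := by linarith
  refine le_trans ?_ (ENNReal.lintegral_Lp_add_le (hf.edist hg).aemeasurable
    (hg.edist hh).aemeasurable hp)
  refine ENNReal.rpow_le_rpow (lintegral_mono fun y => ?_) (by positivity)
  exact ENNReal.rpow_le_rpow (edist_triangle _ _ _) hp0

theorem lpEDist_comm {Y : Type*} [MeasurableSpace Y] (m : Measure Y) (f g : Y → X) :
    lpEDist p m f g = lpEDist p m g f := by
  simp only [lpEDist, edist_comm]

theorem rpow_transportCost (hp : 1 ≤ p) (π : Measure (X × X)) :
    transportCost p π ^ p = ∫⁻ z, edist z.1 z.2 ^ p ∂π := by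
  rw [transportCost, ← ENNReal.rpow_mul, one_div_mul_cancel (by linarith), ENNReal.rpow_one]

theorem rpow_measureWasserstein (hp : 1 ≤ p) (μ ν : Measure X) :
    measureWasserstein p μ ν ^ p = ⨅ π ∈ measureCouplings μ ν, ∫⁻ z, edist z.1 z.2 ^ p ∂π := by
  rw [measureWasserstein, ← ENNReal.rpow_mul, one_div_mul_cancel (by linarith), ENNReal.rpow_one]

theorem measureWasserstein_le_transportCost (hp : 1 ≤ p) {μ ν : Measure X}
    {π : Measure (X × X)} (h : π ∈ measureCouplings μ ν) :
    measureWasserstein p μ ν ≤ transportCost p π :=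
  ENNReal.rpow_le_rpow (iInf₂_le π h) (by positivity)

theorem exists_transportCost_lt (hp : 1 ≤ p) {μ ν : Measure X} {c : ℝ≥0∞}
    (h : measureWasserstein p μ ν < c) : ∃ π ∈ measureCouplings μ ν, transportCost p π < c := by
  have hp0 : 0 < p := by linarith
  rw [measureWasserstein, one_div, ENNReal.rpow_inv_lt_iff hp0] at h
  simp only [iInf_lt_iff] at h
  obtain ⟨π, hπ, hlt⟩ := h
  exact ⟨π, hπ, by rwa [transportCost, one_div, ENNReal.rpow_inv_lt_iff hp0]⟩

theorem exists_transportCost_le_add (hp : 1 ≤ p) (μ ν : Measure X) [IsProbabilityMeasure μ]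
    [IsProbabilityMeasure ν] {ε : ℝ≥0∞} (hε : ε ≠ 0) :
    ∃ π ∈ measureCouplings μ ν, transportCost p π ≤ measureWasserstein p μ ν + ε := by
  rcases eq_or_ne (measureWasserstein p μ ν) ∞ with h | h
  · exact ⟨_, prod_mem_measureCouplings μ ν, by simp [h]⟩
  · obtain ⟨π, hπ, hlt⟩ := exists_transportCost_lt hp (ENNReal.lt_add_right h hε)
    exact ⟨π, hπ, hlt.le⟩

theorem measureWasserstein_comm (hp : 1 ≤ p) (μ ν : Measure X) :
    measureWasserstein p μ ν = measureWasserstein p ν μ := by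
  have key : ∀ μ ν : Measure X, measureWasserstein p μ ν ≤ measureWasserstein p ν μ := by
    intro μ ν
    refine le_of_forall_gt fun c hc => ?_
    obtain ⟨π, hπ, hlt⟩ := exists_transportCost_lt hp hc
    refine (measureWasserstein_le_transportCost hp (swap_mem_measureCouplings hπ)).trans_lt ?_
    rwa [transportCost_swap]
  exact (key μ ν).antisymm (key ν μ)

theorem measureWasserstein_map_le {Y : Type*} [MeasurableSpace Y] (m : Measure Y)
    [IsProbabilityMeasure m] (hp : 1 ≤ p) {f g : Y → X} (hf : Measurable f) (hg : Measurable g) :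
    measureWasserstein p (m.map f) (m.map g) ≤ lpEDist p m f g := by
  rw [← transportCost_map m hf hg]
  refine measureWasserstein_le_transportCost hp
    ⟨Measure.isProbabilityMeasure_map (by fun_prop), ?_, ?_⟩
  · rw [Measure.fst_map_prodMk hg]
  · rw [Measure.snd_map_prodMk hf]

theorem measureWasserstein_self (hp : 1 ≤ p) (μ : Measure X) [IsProbabilityMeasure μ] :
    measureWasserstein p μ μ = 0 := by
  have h := measureWasserstein_map_le μ hp (f := id) (g := id) measurable_id measurable_id
  have hp0 : 0 < p := by linarith
  simpa [lpEDist, hp0] using h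

theorem measureWasserstein_dirac_le (hp : 1 ≤ p) (μ : Measure X) [IsProbabilityMeasure μ]
    (x₀ : X) :
    measureWasserstein p μ (Measure.dirac x₀) ≤ (∫⁻ x, edist x x₀ ^ p ∂μ) ^ (1 / p) := by
  have h := measureWasserstein_map_le μ hp (f := id) (g := fun _ => x₀) measurable_id
    measurable_const
  rwa [Measure.map_id, Measure.map_const, measure_univ, one_smul] at h

/-- Under a coupling, mass starting in `F` either lands in the `δ`-thickening of `F` or moves by at
least `δ`. Cheap couplings make the second case negligible, and the thickenings shrink to the closed
set `F` as `δ` tends to `0`. -/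
theorem measure_le_of_measureWasserstein_eq_zero (hp : 1 ≤ p) {μ ν : Measure X}
    [IsProbabilityMeasure ν] (h : measureWasserstein p μ ν = 0) {F : Set X} (hF : IsClosed F) :
    μ F ≤ ν F := by
  have hp0 : 0 < p := by linarith
  have key : ∀ δ : ℝ, 0 < δ → μ F ≤ ν (Metric.thickening δ F) := by
    intro δ hδ
    refine ENNReal.le_of_forall_pos_le_add fun ε hε _ => ?_
    have hδ' : ENNReal.ofReal δ ^ p ≠ 0 := by simp [hδ]
    have hδ'' : ENNReal.ofReal δ ^ p ≠ ∞ := by simp [hp0.le]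
    -- The threshold is chosen so that Markov's inequality at level `δ ^ p` leaves mass at most `ε`.
    obtain ⟨π, ⟨h0, h1, h2⟩, hlt⟩ := exists_transportCost_lt hp
      (c := (ε * ENNReal.ofReal δ ^ p) ^ (1 / p))
      (by
        rw [h]
        exact ENNReal.rpow_pos_of_nonneg
          (pos_iff_ne_zero.2 (mul_ne_zero (by simpa using hε.ne') hδ')) (by positivity))
    rw [transportCost, ENNReal.rpow_lt_rpow_iff (by positivity)] at hlt
    have hsub : Prod.fst ⁻¹' F ⊆ Prod.snd ⁻¹' Metric.thickening δ F ∪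
        {z : X × X | ENNReal.ofReal δ ^ p ≤ edist z.1 z.2 ^ p} := by
      intro z hz
      by_cases hd : edist z.2 z.1 < ENNReal.ofReal δ
      · left
        rw [Set.mem_preimage, Metric.mem_thickening_iff_exists_edist_lt]
        exact ⟨z.1, hz, hd⟩
      · right
        rw [edist_comm] at hd
        exact ENNReal.rpow_le_rpow (not_lt.1 hd) hp0.le
    calc μ F = π (Prod.fst ⁻¹' F) := by rw [← h1, Measure.fst_apply hF.measurableSet]
      _ ≤ _ := (measure_mono hsub).trans (measure_union_le _ _)
      _ ≤ ν (Metric.thickening δ F) + ε := by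
        gcongr
        · rw [← h2, Measure.snd_apply Metric.isOpen_thickening.measurableSet]
        · refine (meas_ge_le_lintegral_div (measurable_edist_rpow p).aemeasurable hδ' hδ'').trans ?_
          exact ENNReal.div_le_of_le_mul hlt.le
  refine ge_of_tendsto (tendsto_measure_thickening_of_isClosed ⟨1, one_pos, measure_ne_top _ _⟩ hF)
    (eventually_nhdsWithin_of_forall key)

theorem eq_of_measureWasserstein_eq_zero (hp : 1 ≤ p) {μ ν : Measure X}
    [IsProbabilityMeasure μ] [IsProbabilityMeasure ν] (h : measureWasserstein p μ ν = 0) :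
    μ = ν := by
  have h' := h
  rw [measureWasserstein_comm hp] at h'
  refine ext_of_generate_finite _ (BorelSpace.measurable_eq.trans borel_eq_generateFrom_isClosed)
    isPiSystem_isClosed (fun F hF => ?_) (by simp)
  exact (measure_le_of_measureWasserstein_eq_zero hp h hF).antisymm
    (measure_le_of_measureWasserstein_eq_zero hp h' hF)

end Cost

/-! ### Gluing of couplings and the triangle inequality -/

section Gluing

variable {Ω X : Type*} [MeasurableSpace Ω] [MeasurableSpace X]

theorem kernel_compProd_map_fst_prod {Y Z : Type*} [MeasurableSpace Y] [MeasurableSpace Z]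
    (ν : Kernel Ω X) [IsMarkovKernel ν] (κ₁ : Kernel (Ω × X) Y) (κ₂ : Kernel (Ω × X) Z)
    [IsMarkovKernel κ₁] [IsMarkovKernel κ₂] :
    (ν ⊗ₖ (κ₁ ×ₖ κ₂)).map (fun z => (z.1, z.2.1)) = ν ⊗ₖ κ₁ := by
  ext ω s hs
  rw [Kernel.map_apply' _ (by fun_prop) _ hs, Kernel.compProd_apply (by measurability),
    Kernel.compProd_apply hs]
  refine lintegral_congr fun x => ?_
  conv_rhs => rw [← Kernel.fst_prod κ₁ κ₂, Kernel.fst_apply' _ _ (by measurability)]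
  rfl

theorem kernel_compProd_map_snd_prod {Y Z : Type*} [MeasurableSpace Y] [MeasurableSpace Z]
    (ν : Kernel Ω X) [IsMarkovKernel ν] (κ₁ : Kernel (Ω × X) Y) (κ₂ : Kernel (Ω × X) Z)
    [IsMarkovKernel κ₁] [IsMarkovKernel κ₂] :
    (ν ⊗ₖ (κ₁ ×ₖ κ₂)).map (fun z => (z.1, z.2.2)) = ν ⊗ₖ κ₂ := by
  ext ω s hs
  rw [Kernel.map_apply' _ (by fun_prop) _ hs, Kernel.compProd_apply (by measurability),
    Kernel.compProd_apply hs]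
  refine lintegral_congr fun x => ?_
  conv_rhs => rw [← Kernel.snd_prod κ₁ κ₂, Kernel.snd_apply' _ _ (by measurability)]
  rfl

/-- Gluing, done for all `ω` at once: disintegrate both couplings over the common marginal `ν`, make
the outer coordinates conditionally independent given the middle one, then forget the latter. The
cost bound is Minkowski's inequality for the glued law. -/
theorem exists_kernelCouplings_trans [MetricSpace X] [SecondCountableTopology X] [CompleteSpace X]
    [BorelSpace X] [Nonempty X] {p : ℝ} (hp : 1 ≤ p) {μ ν η : Kernel Ω X} [IsMarkovKernel ν]
    {π ρ : Kernel Ω (X × X)} (hπ : π ∈ kernelCouplings μ ν) (hρ : ρ ∈ kernelCouplings ν η) :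
    ∃ σ ∈ kernelCouplings μ η,
      ∀ ω, transportCost p (σ ω) ≤ transportCost p (π ω) + transportCost p (ρ ω) := by
  obtain ⟨i1, h11, h12⟩ := swapRight_mem_kernelCouplings hπ
  obtain ⟨i2, h21, h22⟩ := hρ
  set κ₁ := (Kernel.swapRight π).condKernel
  set κ₂ := ρ.condKernel
  have e1 : ν ⊗ₖ κ₁ = Kernel.swapRight π := by
    rw [← h11]; exact Kernel.disintegrate _ _
  have e2 : ν ⊗ₖ κ₂ = ρ := by
    rw [← h21]; exact Kernel.disintegrate _ _
  -- The coordinates of `τ` are ordered (middle, first, last); this is why `π` was swapped.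
  set τ := ν ⊗ₖ (κ₁ ×ₖ κ₂)
  have t1 : τ.map (fun z => (z.1, z.2.1)) = Kernel.swapRight π :=
    (kernel_compProd_map_fst_prod ν κ₁ κ₂).trans e1
  have t2 : τ.map (fun z => (z.1, z.2.2)) = ρ := (kernel_compProd_map_snd_prod ν κ₁ κ₂).trans e2
  have m1 : τ.map (fun z => z.2.1) = μ := by
    rw [← h12, ← t1, Kernel.snd_map_prod _ (by fun_prop)]
  have m2 : τ.map (fun z => z.2.2) = η := by
    rw [← h22, ← t2, Kernel.snd_map_prod _ (by fun_prop)]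
  refine ⟨τ.map fun z => (z.2.1, z.2.2), ⟨Kernel.IsMarkovKernel.map _ (by fun_prop), ?_, ?_⟩,
    fun ω => ?_⟩
  · rw [Kernel.fst_map_prod _ (by fun_prop), m1]
  · rw [Kernel.snd_map_prod _ (by fun_prop), m2]
  · have c1 : transportCost p (π ω) = lpEDist p (τ ω) (fun z => z.1) (fun z => z.2.1) := by
      rw [← transportCost_map _ (by fun_prop) (by fun_prop), ← Kernel.map_apply _ (by fun_prop), t1,
        Kernel.swapRight_apply, transportCost_swap]
    have c2 : transportCost p (ρ ω) = lpEDist p (τ ω) (fun z => z.1) (fun z => z.2.2) := by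
      rw [← transportCost_map _ (by fun_prop) (by fun_prop), ← Kernel.map_apply _ (by fun_prop), t2]
    rw [Kernel.map_apply _ (by fun_prop), transportCost_map _ (by fun_prop) (by fun_prop), c1, c2,
      lpEDist_comm _ (fun z : X × X × X => z.1) (fun z => z.2.1)]
    exact lpEDist_triangle _ hp (by fun_prop) (by fun_prop) (by fun_prop)

/-- Measures are constant kernels over `Unit`, so kernel gluing applies; optimal couplings are
avoided by an arbitrarily small loss. -/
theorem measureWasserstein_triangle [MetricSpace X] [SecondCountableTopology X] [CompleteSpace X]
    [BorelSpace X] {p : ℝ} (hp : 1 ≤ p) (μ ν η : Measure X) [IsProbabilityMeasure μ]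
    [IsProbabilityMeasure ν] [IsProbabilityMeasure η] :
    measureWasserstein p μ η ≤ measureWasserstein p μ ν + measureWasserstein p ν η := by
  have : Nonempty X := nonempty_of_isProbabilityMeasure μ
  refine ENNReal.le_of_forall_pos_le_add fun ε hε _ => ?_
  have hε' : (ε : ℝ≥0∞) / 2 ≠ 0 := by simp [hε.ne']
  obtain ⟨π, hπ, h1⟩ := exists_transportCost_le_add hp μ ν hε'
  obtain ⟨ρ, hρ, h2⟩ := exists_transportCost_le_add hp ν η hε'
  obtain ⟨σ, hσ, h3⟩ := exists_kernelCouplings_trans hp (const_mem_kernelCouplings (Ω := Unit) hπ)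
    (const_mem_kernelCouplings hρ)
  have h4 := mem_measureCouplings_of_mem_kernelCouplings hσ ()
  have h5 := h3 ()
  simp only [Kernel.const_apply] at h4 h5
  calc _ ≤ _ := measureWasserstein_le_transportCost hp h4
    _ ≤ _ := h5
    _ ≤ _ := add_le_add h1 h2
    _ = _ := by rw [add_add_add_comm, ENNReal.add_halves]

end Gluing

/-! ### Separability of product measures -/

section SeparableProd

variable {Ω Y : Type*} [mΩ : MeasurableSpace Ω] [mY : MeasurableSpace Y]

/-- Borel–Cantelli: if `A` is approximated by sets of `𝒜` with summable errors, almost every point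
eventually belongs to all or none of them according to whether it lies in `A`, so their limsup is a
version of `A`. -/
theorem exists_measurableSet_generateFrom_ae_eq {P : Measure Ω} [IsFiniteMeasure P]
    {𝒜 : Set (Set Ω)} (h𝒜 : P.MeasureDense 𝒜) {A : Set Ω} (hA : MeasurableSet A) :
    ∃ B, MeasurableSet[MeasurableSpace.generateFrom 𝒜] B ∧ A =ᵐ[P] B := by
  obtain ⟨δ, hδ, hsum⟩ := ENNReal.exists_pos_sum_of_countable' (one_ne_zero (α := ℝ≥0∞)) ℕ
  have hδ' : ∀ n, δ n ≠ ∞ := fun n => ENNReal.ne_top_of_tsum_ne_top (hsum.trans ENNReal.one_lt_top).ne n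
  have : ∀ n, ∃ t ∈ 𝒜, P (symmDiff A t) < δ n := by
    intro n
    obtain ⟨t, ht, h⟩ := h𝒜.approx A hA (measure_ne_top _ _) (δ n).toReal
      (ENNReal.toReal_pos (hδ n).ne' (hδ' n))
    exact ⟨t, ht, by rwa [ENNReal.ofReal_toReal (hδ' n)] at h⟩
  choose t ht hlt using this
  refine ⟨Filter.limsup t Filter.atTop, ?_, ?_⟩
  · exact @MeasurableSet.measurableSet_limsup _ (MeasurableSpace.generateFrom 𝒜) _ fun n =>
      MeasurableSpace.measurableSet_generateFrom (ht n)
  · have h0 : P (Filter.limsup (fun n => symmDiff A (t n)) Filter.atTop) = 0 :=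
      measure_limsup_atTop_eq_zero
        ((ENNReal.tsum_le_tsum fun n => (hlt n).le).trans_lt (hsum.trans ENNReal.one_lt_top)).ne
    have h1 : ∀ᵐ ω ∂P, ω ∉ Filter.limsup (fun n => symmDiff A (t n)) Filter.atTop :=
      measure_eq_zero_iff_ae_notMem.1 h0
    filter_upwards [h1] with ω hω
    rw [Filter.mem_limsup_iff_frequently_mem, Filter.not_frequently] at hω
    apply propext
    change ω ∈ A ↔ ω ∈ Filter.limsup t Filter.atTop
    rw [Filter.mem_limsup_iff_frequently_mem]
    have h2 : ∀ᶠ n in Filter.atTop, (ω ∈ t n ↔ ω ∈ A) := by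
      filter_upwards [hω] with n hn
      rw [Set.mem_symmDiff] at hn
      tauto
    rw [Filter.frequently_congr h2]
    simp

theorem exists_countable_measureDense_of_countablyGenerated {α : Type*} {m : MeasurableSpace α}
    (hcg : MeasurableSpace.CountablyGenerated α) (P : Measure α) [IsFiniteMeasure P] :
    ∃ 𝒜, 𝒜.Countable ∧ P.MeasureDense 𝒜 :=
  exists_countable_measureDense P

theorem isSeparable_of_ae_eq {α : Type*} {m mα : MeasurableSpace α} (hm : m ≤ mα)
    {P : Measure α} [IsFiniteMeasure P] (hcg : @MeasurableSpace.CountablyGenerated α m)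
    (h : ∀ s, MeasurableSet s → ∃ t, MeasurableSet[m] t ∧ s =ᵐ[P] t) :
    MeasureTheory.IsSeparable P := by
  obtain ⟨𝒜, hc, h𝒜⟩ := @exists_countable_measureDense_of_countablyGenerated α m hcg (P.trim hm)
    (isFiniteMeasure_trim hm)
  have hmeas := @Measure.MeasureDense.measurable α m _ _ h𝒜
  refine ⟨𝒜, hc, fun s hs => hm _ (hmeas s hs), fun s hs _ ε hε => ?_⟩
  obtain ⟨t, ht, hst⟩ := h s hs
  obtain ⟨u, hu, hlt⟩ := @Measure.MeasureDense.approx α m _ _ h𝒜 t ht (measure_ne_top _ _) ε hε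
  refine ⟨u, hu, ?_⟩
  rw [measure_congr (hst.symmDiff (Filter.EventuallyEq.refl _ u))]
  rwa [trim_measurableSet_eq hm (@MeasurableSet.symmDiff _ m _ _ ht (hmeas u hu))] at hlt

/-- The sets with an a.e. version in the smaller product σ-algebra contain the rectangles and are
stable under complements and countable unions, so they exhaust the product σ-algebra; the smaller
one is countably generated. -/
theorem isSeparable_prod_of_ae_eq {α : Type*} {m₀ mα : MeasurableSpace α} (hm₀ : m₀ ≤ mα)
    {P : Measure α} [IsFiniteMeasure P] (hcg : @MeasurableSpace.CountablyGenerated α m₀)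
    (h : ∀ s, MeasurableSet s → ∃ t, MeasurableSet[m₀] t ∧ s =ᵐ[P] t)
    (m : Measure Y) [IsFiniteMeasure m] [MeasurableSpace.CountablyGenerated Y] :
    MeasureTheory.IsSeparable (P.prod m) := by
  have hle : m₀.prod mY ≤ mα.prod mY := sup_le_sup (MeasurableSpace.comap_mono hm₀) le_rfl
  have hcg' : @MeasurableSpace.CountablyGenerated (α × Y) (m₀.prod mY) :=
    @MeasurableSpace.instCountablyGeneratedProd _ _ m₀ hcg mY _
  refine isSeparable_of_ae_eq hle hcg' fun s hs => ?_
  rw [show mα.prod mY = _ from generateFrom_prod.symm] at hs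
  induction s, hs using MeasurableSpace.generateFrom_induction with
  | hC s hs _ =>
    obtain ⟨A, hA, B, hB, rfl⟩ := hs
    obtain ⟨A', hA', hAA'⟩ := h A hA
    exact ⟨A' ×ˢ B, @MeasurableSet.prod _ _ m₀ mY _ _ hA' hB,
      Measure.set_prod_ae_eq hAA' (Filter.EventuallyEq.refl _ _)⟩
  | empty => exact ⟨∅, @MeasurableSet.empty _ (m₀.prod mY), Filter.EventuallyEq.rfl⟩
  | compl s _ hs =>
    obtain ⟨t, ht, hst⟩ := hs
    exact ⟨tᶜ, @MeasurableSet.compl _ _ (m₀.prod mY) ht, hst.compl⟩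
  | iUnion s _ hs =>
    choose t ht hst using hs
    exact ⟨⋃ n, t n, @MeasurableSet.iUnion _ _ (m₀.prod mY) _ _ ht,
      Filter.EventuallyEq.countable_iUnion hst⟩

theorem isSeparable_prod (P : Measure Ω) [IsFiniteMeasure P] [MeasureTheory.IsSeparable P]
    (m : Measure Y) [IsFiniteMeasure m] [MeasurableSpace.CountablyGenerated Y] :
    MeasureTheory.IsSeparable (P.prod m) := by
  obtain ⟨𝒜, hc, h𝒜⟩ := exists_countable_measureDense P
  exact isSeparable_prod_of_ae_eq (m₀ := MeasurableSpace.generateFrom 𝒜)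
    (MeasurableSpace.generateFrom_le fun s hs => h𝒜.measurable s hs) (@MeasurableSpace.CountablyGenerated.mk _ (_) ⟨𝒜, hc, rfl⟩)
    (fun s hs => exists_measurableSet_generateFrom_ae_eq h𝒜 hs) m

end SeparableProd

/-! ### Separability of `L^p` spaces of metric-valued functions -/

section DenseSequence

/-- This makes separability of vector-valued `Lp` available for `X`-valued functions. The bounded
sequences are not separable, hence the restriction to the span of the Kuratowski image. -/
theorem exists_isometry_separable_normedSpace (X : Type*) [MetricSpace X]
    [SecondCountableTopology X] :
    ∃ E : Submodule ℝ (lp (fun _ : ℕ => ℝ) ∞), TopologicalSpace.SeparableSpace E ∧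
      ∃ ι : X → E, Isometry ι := by
  obtain ⟨f, hf⟩ := KuratowskiEmbedding.exists_isometric_embedding X
  refine ⟨Submodule.span ℝ (Set.range f), ?_,
    fun x => ⟨f x, Submodule.subset_span (Set.mem_range_self x)⟩, fun x y => hf x y⟩
  exact ((TopologicalSpace.isSeparable_range hf.continuous).span).separableSpace

/-- Functions into a separable metric space with finite `p`-th moment form an `L^p`-separable
family: some sequence of them is `L^p`-dense. -/
theorem exists_dense_seq_lpEDist {Y X : Type*} [MeasurableSpace Y] (m : Measure Y)
    [IsFiniteMeasure m] [IsSeparable m] [MetricSpace X] [SecondCountableTopology X]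
    [MeasurableSpace X] [BorelSpace X] {p : ℝ} (hp : 1 ≤ p) (x₀ : X) :
    ∃ h : ℕ → Y → X, (∀ i, Measurable (h i) ∧ lpEDist p m (h i) (fun _ => x₀) < ∞) ∧
      ∀ f : Y → X, Measurable f → lpEDist p m f (fun _ => x₀) < ∞ → ∀ ε : ℝ≥0∞, ε ≠ 0 →
        ∃ i, lpEDist p m f (h i) < ε := by
  have hp0 : 0 < p := by linarith
  obtain ⟨E, hE, ι, hι⟩ := exists_isometry_separable_normedSpace X
  have hq1 : Fact (1 ≤ ENNReal.ofReal p) := ⟨by simpa using hp⟩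
  have hq2 : Fact (ENNReal.ofReal p ≠ ∞) := ⟨ENNReal.ofReal_ne_top⟩
  have hcomp : ∀ f : Y → X, Measurable f → AEStronglyMeasurable (fun y => ι (f y)) m :=
    fun f hf => (hι.continuous.comp_stronglyMeasurable hf.stronglyMeasurable).aestronglyMeasurable
  have hnorm : ∀ f g : Y → X,
      eLpNorm (fun y => ι (f y) - ι (g y)) (ENNReal.ofReal p) m = lpEDist p m f g := by
    intro f g
    rw [eLpNorm_eq_lintegral_rpow_enorm_toReal (by simpa using hp0) ENNReal.ofReal_ne_top,
      ENNReal.toReal_ofReal hp0.le, lpEDist]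
    simp only [← edist_eq_enorm_sub, hι.edist_eq]
  have hmem : ∀ f : Y → X, Measurable f → lpEDist p m f (fun _ => x₀) < ∞ →
      MemLp (fun y => ι (f y)) (ENNReal.ofReal p) m := by
    intro f hf hfin
    have h1 : MemLp (fun y => ι (f y) - ι x₀) (ENNReal.ofReal p) m :=
      ⟨(hcomp f hf).sub aestronglyMeasurable_const, by rwa [hnorm f (fun _ => x₀)]⟩
    refine (h1.add (memLp_const (ι x₀))).ae_eq (Filter.Eventually.of_forall fun y => ?_)
    simp
  let T := {f : Y → X // Measurable f ∧ lpEDist p m f (fun _ => x₀) < ∞}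
  let Φ : T → Lp E (ENNReal.ofReal p) m := fun f => (hmem f.1 f.2.1 f.2.2).toLp _
  have hΦ : ∀ f g : T, edist (Φ f) (Φ g) = lpEDist p m f.1 g.1 := by
    intro f g
    rw [Lp.edist_toLp_toLp, ← hnorm]
    rfl
  have : Nonempty T := ⟨fun _ => x₀, measurable_const, by simp [lpEDist, hp0]⟩
  -- Density is taken inside the range of `Φ`, so that the approximants come from functions with
  -- values in `X`.
  let d := TopologicalSpace.denseSeq (Set.range Φ)
  choose h hh using fun i => (d i).2
  refine ⟨fun i => (h i).1, fun i => (h i).2, fun f hf hfin ε hε => ?_⟩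
  obtain ⟨i, hi⟩ := (TopologicalSpace.denseRange_denseSeq (Set.range Φ)).exists_mem_open
    (Metric.isOpen_eball (x := (⟨Φ ⟨f, hf, hfin⟩, Set.mem_range_self _⟩ : Set.range Φ)) (ε := ε))
    ⟨_, Metric.mem_eball_self (pos_iff_ne_zero.2 hε)⟩
  rw [Metric.mem_eball'] at hi
  refine ⟨i, ?_⟩
  rwa [Subtype.edist_eq, ← hh i, hΦ] at hi

end DenseSequence

/-! ### Measurable choice of nearly optimal couplings and the integral formula -/

section Selection

variable {Ω X : Type*} [MeasurableSpace Ω] [MeasurableSpace X] [MetricSpace X]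
  [SecondCountableTopology X] [BorelSpace X] {p : ℝ}

theorem lpEDist_lt_top_iff {Y : Type*} [MeasurableSpace Y] (hp : 1 ≤ p) (m : Measure Y)
    (f g : Y → X) : lpEDist p m f g < ∞ ↔ ∫⁻ y, edist (f y) (g y) ^ p ∂m < ∞ :=
  ENNReal.rpow_lt_top_iff_of_pos (by positivity)

theorem rpow_lpEDist {Y : Type*} [MeasurableSpace Y] (hp : 1 ≤ p) (m : Measure Y)
    (f g : Y → X) : lpEDist p m f g ^ p = ∫⁻ y, edist (f y) (g y) ^ p ∂m := by
  rw [lpEDist, ← ENNReal.rpow_mul, one_div_mul_cancel (by linarith), ENNReal.rpow_one]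

theorem lpEDist_const_lt_top {Y : Type*} [MeasurableSpace Y] (hp : 1 ≤ p) (m : Measure Y)
    [IsFiniteMeasure m] {f : Y → X} (hf : Measurable f) {x₀ : X}
    (h : lpEDist p m f (fun _ => x₀) < ∞) (x₁ : X) : lpEDist p m f (fun _ => x₁) < ∞ := by
  refine (lpEDist_triangle m hp hf measurable_const measurable_const).trans_lt
    (ENNReal.add_lt_top.2 ⟨h, ?_⟩)
  rw [lpEDist_lt_top_iff hp, lintegral_const]
  exact ENNReal.mul_lt_top (ENNReal.rpow_lt_top_of_nonneg (by linarith) (edist_ne_top _ _))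
    (measure_lt_top _ _)

/-- A choice of an index in a countable family of measurable sets, whenever there is one, can be
made measurably. -/
theorem exists_measurable_index (A : ℕ → Set Ω) (hA : ∀ n, MeasurableSet (A n)) :
    ∃ i : Ω → ℕ, Measurable i ∧ ∀ ω, (∃ n, ω ∈ A n) → ω ∈ A (i ω) := by
  classical
  -- The second alternative makes `Nat.find` total: where no index works, it returns `0`.
  let q : Ω → ℕ → Prop := fun ω n => ω ∈ A n ∨ ∀ k, ω ∉ A k
  have hq : ∀ ω, ∃ n, q ω n := fun ω => by
    by_cases h : ∃ n, ω ∈ A n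
    · exact h.imp fun n hn => Or.inl hn
    · exact ⟨0, Or.inr (not_exists.1 h)⟩
  refine ⟨fun ω => Nat.find (hq ω), measurable_find hq fun n => ?_, fun ω h => ?_⟩
  · have h : {ω | q ω n} = A n ∪ ⋂ k, (A k)ᶜ := by
      ext ω
      simp [q]
    rw [h]
    exact (hA n).union (MeasurableSet.iInter fun k => (hA k).compl)
  · rcases Nat.find_spec (hq ω) with h' | h'
    · exact h'
    · exact absurd h (not_exists.2 h')

/-- The kernel from `ℕ` given by a sequence of measures. -/
noncomputable def seqKernel (m : ℕ → Measure X) : Kernel ℕ X := ⟨m, measurable_from_top⟩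

/-- There is a sequence of laws such that every kernel with almost surely finite `p`-th moments can
be measurably coupled, within `ε`, to a measurable choice of laws in this sequence. -/
theorem exists_seq_coupling [CompleteSpace X] (hp : 1 ≤ p) (x₀ : X) :
    ∃ m : ℕ → Measure X, (∀ i, IsProbabilityMeasure (m i)) ∧
      ∀ (P : Measure Ω) (μ : Kernel Ω X), IsMarkovKernel μ →
        (∀ᵐ ω ∂P, lpEDist p (μ ω) id (fun _ => x₀) < ∞) → ∀ ε : ℝ≥0∞, ε ≠ 0 →
        ∃ (i : Ω → ℕ) (hi : Measurable i),
          ∃ π ∈ kernelCouplings μ ((seqKernel m).comap i hi), ∀ᵐ ω ∂P, transportCost p (π ω) ≤ ε := by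
  have : Nonempty X := ⟨x₀⟩
  obtain ⟨h, hh, hdense⟩ := exists_dense_seq_lpEDist (volume : Measure unitInterval) hp x₀
  refine ⟨fun i => volume.map (h i),
    fun i => Measure.isProbabilityMeasure_map (hh i).1.aemeasurable, fun P μ hμ hfin ε hε => ?_⟩
  obtain ⟨F, hF, hFμ⟩ := Kernel.exists_measurable_map_eq_unitInterval μ
  have hFω : ∀ ω, Measurable (F ω) := fun ω => hF.comp measurable_prodMk_left
  -- `i ω` selects a member of the dense sequence of functions close to `F ω`; feeding both the same
  -- uniform variable yields the coupling.
  obtain ⟨i, hi, hiA⟩ := exists_measurable_index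
    (fun n => {ω | lpEDist p volume (F ω) (h n) < ε}) fun n => by
      refine measurableSet_lt (Measurable.pow_const ?_ _) measurable_const
      exact Measurable.lintegral_prod_right
        (((hF.edist ((hh n).1.comp measurable_snd)).pow_const p))
  have hhi : Measurable fun z : Ω × unitInterval => h (i z.1) z.2 := by
    have : Measurable fun z : ℕ × unitInterval => h z.1 z.2 :=
      measurable_from_prod_countable_right fun n => (hh n).1
    exact this.comp ((hi.comp measurable_fst).prodMk measurable_snd)
  have e1 : lawKernel volume (Function.uncurry F) = μ := by
    ext ω : 1
    rw [lawKernel_apply _ hF, ← hFμ]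
    rfl
  have e2 : lawKernel volume (fun z : Ω × unitInterval => h (i z.1) z.2) =
      (seqKernel fun i => volume.map (h i)).comap i hi := by
    ext ω : 1
    rw [lawKernel_apply _ hhi, Kernel.comap_apply]
    rfl
  refine ⟨i, hi, lawKernel volume fun z => (Function.uncurry F z, h (i z.1) z.2), ?_, ?_⟩
  · have := lawKernel_prodMk_mem_kernelCouplings volume hF hhi
    rwa [e1, e2] at this
  · filter_upwards [hfin] with ω hω
    have h1 : lpEDist p volume (F ω) (fun _ => x₀) < ∞ := by
      rwa [← hFμ, lpEDist, lintegral_map ((measurable_id.edist measurable_const).pow_const p)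
        (hFω ω)] at hω
    have h2 := hiA ω (hdense (F ω) (hFω ω) h1 ε hε)
    rw [lawKernel_apply _ (hF.prodMk hhi)]
    exact (transportCost_map _ (hFω ω) (hh _).1).trans_le h2.le

/-- Measurable choice of almost optimal couplings. -/
theorem exists_kernelCouplings_le_add [CompleteSpace X] (hp : 1 ≤ p) (P : Measure Ω)
    (μ ν : Kernel Ω X) [IsMarkovKernel μ] [IsMarkovKernel ν] {x₀ : X}
    (hμ : ∀ᵐ ω ∂P, lpEDist p (μ ω) id (fun _ => x₀) < ∞)
    (hν : ∀ᵐ ω ∂P, lpEDist p (ν ω) id (fun _ => x₀) < ∞) {ε : ℝ≥0∞} (hε : ε ≠ 0) :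
    ∃ π ∈ kernelCouplings μ ν,
      ∀ᵐ ω ∂P, transportCost p (π ω) ≤ measureWasserstein p (μ ω) (ν ω) + ε := by
  have : Nonempty X := ⟨x₀⟩
  -- Five errors: two for moving to the sequence, one for `γ`, and two more for comparing the
  -- distance of the chosen laws with that of `μ ω` and `ν ω`.
  have hδ : ε / 5 ≠ 0 := by simp [hε]
  obtain ⟨m, hm, H⟩ := exists_seq_coupling (Ω := Ω) hp x₀
  obtain ⟨i, hi, π₁, hπ₁, hc₁⟩ := H P μ inferInstance hμ _ hδ
  obtain ⟨j, hj, π₂, hπ₂, hc₂⟩ := H P ν inferInstance hν _ hδ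
  -- There are only countably many pairs of laws, so an arbitrary choice of couplings is measurable
  -- in the pair of indices.
  choose γ hγ hγc using fun k : ℕ × ℕ => exists_transportCost_le_add hp (m k.1) (m k.2) hδ
  let Γ : Kernel (ℕ × ℕ) (X × X) := ⟨γ, measurable_from_prod_countable_right
    fun n => measurable_from_top⟩
  have hij : Measurable fun ω => (i ω, j ω) := hi.prodMk hj
  have hΓ : Γ.comap _ hij ∈ kernelCouplings ((seqKernel m).comap i hi)
      ((seqKernel m).comap j hj) := by
    refine ⟨⟨fun ω => (hγ (i ω, j ω)).1⟩, ?_, ?_⟩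
    · ext ω : 1
      rw [Kernel.fst_apply]
      exact (hγ (i ω, j ω)).2.1
    · ext ω : 1
      rw [Kernel.snd_apply]
      exact (hγ (i ω, j ω)).2.2
  have M1 : IsMarkovKernel ((seqKernel m).comap i hi) := ⟨fun ω => hm (i ω)⟩
  have M2 : IsMarkovKernel ((seqKernel m).comap j hj) := ⟨fun ω => hm (j ω)⟩
  obtain ⟨σ, hσ, hσc⟩ := exists_kernelCouplings_trans hp hπ₁ hΓ
  obtain ⟨τ, hτ, hτc⟩ := exists_kernelCouplings_trans hp hσ (swapRight_mem_kernelCouplings hπ₂)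
  refine ⟨τ, hτ, ?_⟩
  filter_upwards [hc₁, hc₂] with ω h₁ h₂
  have w₁ := measureWasserstein_le_transportCost hp
    (mem_measureCouplings_of_mem_kernelCouplings hπ₁ ω)
  have w₂ := measureWasserstein_le_transportCost hp
    (mem_measureCouplings_of_mem_kernelCouplings hπ₂ ω)
  have e₂ : transportCost p (Kernel.swapRight π₂ ω) = transportCost p (π₂ ω) := by
    rw [Kernel.swapRight_apply, transportCost_swap]
  have := hm (i ω)
  have := hm (j ω)
  have t₁ : measureWasserstein p (m (i ω)) (m (j ω)) ≤
      measureWasserstein p (μ ω) (ν ω) + (ε / 5 + ε / 5) := by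
    refine (measureWasserstein_triangle hp _ (μ ω) _).trans ?_
    refine (add_le_add le_rfl (measureWasserstein_triangle hp _ (ν ω) _)).trans ?_
    rw [measureWasserstein_comm hp, add_left_comm]
    exact add_le_add le_rfl (add_le_add (w₁.trans h₁) (w₂.trans h₂))
  calc transportCost p (τ ω)
      ≤ (transportCost p (π₁ ω) + transportCost p (γ (i ω, j ω))) + transportCost p (π₂ ω) := by
        rw [← e₂]
        exact (hτc ω).trans (add_le_add (hσc ω) le_rfl)
    _ ≤ (ε / 5 + (measureWasserstein p (μ ω) (ν ω) + (ε / 5 + ε / 5) + ε / 5)) + ε / 5 := by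
        gcongr
        exact (hγc (i ω, j ω)).trans (add_le_add t₁ le_rfl)
    _ = measureWasserstein p (μ ω) (ν ω) + 5 * (ε / 5) := by ring
    _ = _ := by rw [ENNReal.mul_div_cancel (by norm_num) (by norm_num)]

theorem measurable_transportCost (π : Kernel Ω (X × X)) :
    Measurable fun ω => transportCost p (π ω) :=
  (Measurable.lintegral_kernel (measurable_edist_rpow p)).pow_const _

theorem aemeasurable_measureWasserstein [CompleteSpace X] (hp : 1 ≤ p) (P : Measure Ω)
    (μ ν : Kernel Ω X) [IsMarkovKernel μ] [IsMarkovKernel ν] {x₀ : X}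
    (hμ : ∀ᵐ ω ∂P, lpEDist p (μ ω) id (fun _ => x₀) < ∞)
    (hν : ∀ᵐ ω ∂P, lpEDist p (ν ω) id (fun _ => x₀) < ∞) :
    AEMeasurable (fun ω => measureWasserstein p (μ ω) (ν ω)) P := by
  obtain ⟨u, -, hu0, hu⟩ := exists_seq_strictAnti_tendsto' (zero_lt_one (α := ℝ≥0∞))
  choose π hπ hc using fun n => exists_kernelCouplings_le_add hp P μ ν hμ hν (hu0 n).1.ne'
  refine aemeasurable_of_tendsto_metrizable_ae Filter.atTop
    (fun n => (measurable_transportCost (p := p) (π n)).aemeasurable) ?_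
  filter_upwards [ae_all_iff.2 hc] with ω hω
  refine tendsto_of_tendsto_of_tendsto_of_le_of_le tendsto_const_nhds ?_
    (fun n => measureWasserstein_le_transportCost hp
      (mem_measureCouplings_of_mem_kernelCouplings (hπ n) ω)) hω
  simpa using (tendsto_const_nhds (x := measureWasserstein p (μ ω) (ν ω))).add hu

theorem kernelWasserstein_eq [CompleteSpace X] (hp : 1 ≤ p) (P : Measure Ω)
    [IsProbabilityMeasure P] (μ ν : Kernel Ω X) [IsMarkovKernel μ] [IsMarkovKernel ν] {x₀ : X}
    (hμ : ∀ᵐ ω ∂P, lpEDist p (μ ω) id (fun _ => x₀) < ∞)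
    (hν : ∀ᵐ ω ∂P, lpEDist p (ν ω) id (fun _ => x₀) < ∞) :
    kernelWasserstein P p μ ν =
      (∫⁻ ω, measureWasserstein p (μ ω) (ν ω) ^ p ∂P) ^ (1 / p) := by
  have hp0 : 0 < p := by linarith
  refine le_antisymm ?_ ?_
  · refine ENNReal.le_of_forall_pos_le_add fun ε hε _ => ?_
    obtain ⟨π, hπ, hc⟩ := exists_kernelCouplings_le_add hp P μ ν hμ hν (ε := ε)
      (by simpa using hε.ne')
    calc kernelWasserstein P p μ ν
        ≤ (∫⁻ ω, transportCost p (π ω) ^ p ∂P) ^ (1 / p) := by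
          simp only [rpow_transportCost hp]
          exact ENNReal.rpow_le_rpow (iInf₂_le π hπ) (by positivity)
      _ ≤ (∫⁻ ω, (measureWasserstein p (μ ω) (ν ω) + ε) ^ p ∂P) ^ (1 / p) := by
          refine ENNReal.rpow_le_rpow (lintegral_mono_ae ?_) (by positivity)
          filter_upwards [hc] with ω hω
          exact ENNReal.rpow_le_rpow hω hp0.le
      _ ≤ _ := ENNReal.lintegral_Lp_add_le (aemeasurable_measureWasserstein hp P μ ν hμ hν)
          aemeasurable_const hp
      _ = _ := by
          rw [lintegral_const, measure_univ, mul_one, ← ENNReal.rpow_mul,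
            mul_one_div_cancel hp0.ne', ENNReal.rpow_one]
  -- The easy inequality: each `π ω` competes in the infimum defining `W_p (μ_ω, ν_ω)`.
  · refine ENNReal.rpow_le_rpow (le_iInf₂ fun π hπ => lintegral_mono fun ω => ?_) (by positivity)
    rw [rpow_measureWasserstein hp]
    exact iInf₂_le _ (mem_measureCouplings_of_mem_kernelCouplings hπ ω)

end Selection

/-! ### The metric on classes of kernels -/

section KernelMetric

variable {Ω X : Type*} [MeasurableSpace Ω] {P : Measure Ω} [IsProbabilityMeasure P]
  [MetricSpace X] [SecondCountableTopology X] [MeasurableSpace X] [BorelSpace X] {p : ℝ}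

theorem MomentKernel.isMarkovKernel (μ : MomentKernel P p X) : IsMarkovKernel μ.1 := μ.2.1

theorem MomentKernel.nonempty (μ : MomentKernel P p X) : Nonempty X := ⟨μ.2.2.choose⟩

/-- The moment is an `L^p` distance to a constant on the finite measure `P ⊗ₘ μ`, so changing the
base point preserves finiteness. -/
theorem MomentKernel.lintegral_lt_top (hp : 1 ≤ p) (μ : MomentKernel P p X) (x₀ : X) :
    ∫⁻ ω, lpEDist p (μ.1 ω) id (fun _ => x₀) ^ p ∂P < ∞ := by
  have := μ.isMarkovKernel
  have key : ∀ x : X, ∫⁻ ω, ∫⁻ y, edist y x ^ p ∂(μ.1 ω) ∂P =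
      ∫⁻ z, edist z.2 x ^ p ∂(P ⊗ₘ μ.1) := fun x =>
    (Measure.lintegral_compProd ((measurable_snd.edist measurable_const).pow_const p)).symm
  obtain ⟨x₁, h⟩ := μ.2.2
  rw [key] at h
  simp only [rpow_lpEDist hp, id]
  rw [key]
  exact (lpEDist_lt_top_iff hp _ Prod.snd _).1 (lpEDist_const_lt_top hp _ measurable_snd
    ((lpEDist_lt_top_iff hp _ Prod.snd _).2 h) x₀)

theorem measurable_lpEDist_kernel (κ : Kernel Ω X) (x₀ : X) :
    Measurable fun ω => lpEDist p (κ ω) id (fun _ => x₀) :=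
  (Measurable.lintegral_kernel ((measurable_id.edist measurable_const).pow_const p)).pow_const _

theorem MomentKernel.ae_lt_top (hp : 1 ≤ p) (μ : MomentKernel P p X) (x₀ : X) :
    ∀ᵐ ω ∂P, lpEDist p (μ.1 ω) id (fun _ => x₀) < ∞ := by
  filter_upwards [MeasureTheory.ae_lt_top ((measurable_lpEDist_kernel μ.1 x₀).pow_const p)
    (μ.lintegral_lt_top hp x₀).ne] with ω hω
  exact (ENNReal.rpow_lt_top_iff_of_pos (by linarith)).1 hω

variable [CompleteSpace X]

theorem MomentKernel.aemeasurable_measureWasserstein (hp : 1 ≤ p) (μ ν : MomentKernel P p X) :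
    AEMeasurable (fun ω => measureWasserstein p (μ.1 ω) (ν.1 ω)) P := by
  have := μ.isMarkovKernel
  have := ν.isMarkovKernel
  obtain ⟨x₀⟩ := μ.nonempty
  exact _root_.aemeasurable_measureWasserstein hp P _ _ (μ.ae_lt_top hp x₀) (ν.ae_lt_top hp x₀)

theorem MomentKernel.kernelWasserstein_eq (hp : 1 ≤ p) (μ ν : MomentKernel P p X) :
    kernelWasserstein P p μ.1 ν.1 =
      (∫⁻ ω, measureWasserstein p (μ.1 ω) (ν.1 ω) ^ p ∂P) ^ (1 / p) := by
  have := μ.isMarkovKernel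
  have := ν.isMarkovKernel
  obtain ⟨x₀⟩ := μ.nonempty
  exact _root_.kernelWasserstein_eq hp P _ _ (μ.ae_lt_top hp x₀) (ν.ae_lt_top hp x₀)

theorem MomentKernel.kernelWasserstein_self (hp : 1 ≤ p) (μ : MomentKernel P p X) :
    kernelWasserstein P p μ.1 μ.1 = 0 := by
  have := μ.isMarkovKernel
  have hp0 : 0 < p := by linarith
  rw [μ.kernelWasserstein_eq hp]
  simp [measureWasserstein_self hp, hp0]

theorem MomentKernel.kernelWasserstein_comm (hp : 1 ≤ p) (μ ν : MomentKernel P p X) :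
    kernelWasserstein P p μ.1 ν.1 = kernelWasserstein P p ν.1 μ.1 := by
  rw [μ.kernelWasserstein_eq hp, ν.kernelWasserstein_eq hp]
  simp only [measureWasserstein_comm hp]

theorem MomentKernel.kernelWasserstein_triangle (hp : 1 ≤ p) (μ ν η : MomentKernel P p X) :
    kernelWasserstein P p μ.1 η.1 ≤
      kernelWasserstein P p μ.1 ν.1 + kernelWasserstein P p ν.1 η.1 := by
  have := μ.isMarkovKernel
  have := ν.isMarkovKernel
  have := η.isMarkovKernel
  simp only [MomentKernel.kernelWasserstein_eq hp]
  refine le_trans ?_ (ENNReal.lintegral_Lp_add_le (μ.aemeasurable_measureWasserstein hp ν)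
    (ν.aemeasurable_measureWasserstein hp η) hp)
  refine ENNReal.rpow_le_rpow (lintegral_mono fun ω => ?_) (by positivity)
  exact ENNReal.rpow_le_rpow (measureWasserstein_triangle hp _ _ _) (by linarith)

theorem MomentKernel.ae_eq_of_kernelWasserstein_eq_zero (hp : 1 ≤ p) (μ ν : MomentKernel P p X)
    (h : kernelWasserstein P p μ.1 ν.1 = 0) : ∀ᵐ ω ∂P, μ.1 ω = ν.1 ω := by
  have := μ.isMarkovKernel
  have := ν.isMarkovKernel
  have hp0 : 0 < p := by linarith
  rw [μ.kernelWasserstein_eq hp, ENNReal.rpow_eq_zero_iff_of_pos (by positivity),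
    lintegral_eq_zero_iff' ((μ.aemeasurable_measureWasserstein hp ν).pow_const p)] at h
  filter_upwards [h] with ω hω
  exact eq_of_measureWasserstein_eq_zero hp ((ENNReal.rpow_eq_zero_iff_of_pos hp0).1 hω)

/-- The infimum prescribes marginals for every `ω`, so invariance under a.e. changes is read off the
integral formula instead. -/
theorem MomentKernel.kernelWasserstein_congr (hp : 1 ≤ p) {μ ν μ' ν' : MomentKernel P p X}
    (hμ : ∀ᵐ ω ∂P, μ.1 ω = μ'.1 ω) (hν : ∀ᵐ ω ∂P, ν.1 ω = ν'.1 ω) :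
    kernelWasserstein P p μ.1 ν.1 = kernelWasserstein P p μ'.1 ν'.1 := by
  rw [μ.kernelWasserstein_eq hp, μ'.kernelWasserstein_eq hp]
  congr 1
  refine lintegral_congr_ae ?_
  filter_upwards [hμ, hν] with ω h₁ h₂
  rw [h₁, h₂]

/-- Compare both kernels with the Dirac mass at a fixed point: the distances to it are controlled by
the moments. -/
theorem MomentKernel.kernelWasserstein_ne_top (hp : 1 ≤ p) (μ ν : MomentKernel P p X) :
    kernelWasserstein P p μ.1 ν.1 ≠ ∞ := by
  have := μ.isMarkovKernel
  have := ν.isMarkovKernel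
  obtain ⟨x₀⟩ := μ.nonempty
  have hp0 : 0 < p := by linarith
  rw [μ.kernelWasserstein_eq hp]
  refine ne_top_of_le_ne_top (b := (∫⁻ ω, lpEDist p (μ.1 ω) id (fun _ => x₀) ^ p ∂P) ^ (1 / p) +
    (∫⁻ ω, lpEDist p (ν.1 ω) id (fun _ => x₀) ^ p ∂P) ^ (1 / p)) ?_ ?_
  · exact (ENNReal.add_lt_top.2
      ⟨ENNReal.rpow_lt_top_of_nonneg (by positivity) (μ.lintegral_lt_top hp x₀).ne,
        ENNReal.rpow_lt_top_of_nonneg (by positivity) (ν.lintegral_lt_top hp x₀).ne⟩).ne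
  · refine le_trans ?_ (ENNReal.lintegral_Lp_add_le
      (measurable_lpEDist_kernel μ.1 x₀).aemeasurable
      (measurable_lpEDist_kernel ν.1 x₀).aemeasurable hp)
    refine ENNReal.rpow_le_rpow (lintegral_mono fun ω => ENNReal.rpow_le_rpow ?_ hp0.le)
      (by positivity)
    refine (measureWasserstein_triangle hp _ (Measure.dirac x₀) _).trans (add_le_add ?_ ?_)
    · exact measureWasserstein_dirac_le hp _ _
    · rw [measureWasserstein_comm hp]
      exact measureWasserstein_dirac_le hp _ _

/-- The Wasserstein distance on `K_p(X)` as a metric structure. -/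
noncomputable abbrev kernelSpaceMetric (hp : 1 ≤ p) : MetricSpace (KernelSpace P p X) :=
  letI : EMetricSpace (KernelSpace P p X) :=
    { edist := Quotient.lift₂ (fun μ ν => kernelWasserstein P p μ.1 ν.1)
        fun _ _ _ _ h₁ h₂ => MomentKernel.kernelWasserstein_congr hp h₁ h₂
      edist_self := by
        rintro ⟨μ⟩
        exact μ.kernelWasserstein_self hp
      edist_comm := by
        rintro ⟨μ⟩ ⟨ν⟩
        exact μ.kernelWasserstein_comm hp ν
      edist_triangle := by
        rintro ⟨μ⟩ ⟨ν⟩ ⟨η⟩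
        exact μ.kernelWasserstein_triangle hp ν η
      eq_of_edist_eq_zero := by
        rintro ⟨μ⟩ ⟨ν⟩ h
        exact Quotient.sound (μ.ae_eq_of_kernelWasserstein_eq_zero hp ν h) }
  EMetricSpace.toMetricSpace (by
    rintro ⟨μ⟩ ⟨ν⟩
    exact μ.kernelWasserstein_ne_top hp ν)

theorem edist_kernelSpace_mk (hp : 1 ≤ p) (μ ν : MomentKernel P p X) :
    letI : MetricSpace (KernelSpace P p X) := kernelSpaceMetric hp
    edist (KernelSpace.mk μ) (KernelSpace.mk ν) = kernelWasserstein P p μ.1 ν.1 :=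
  rfl

end KernelMetric

/-! ### Taking laws is 1-Lipschitz; separability of the kernel space -/

section LawKernelDist

variable {Ω Y X : Type*} [MeasurableSpace Ω] {P : Measure Ω} [IsProbabilityMeasure P]
  [MeasurableSpace Y] (m : Measure Y) [IsProbabilityMeasure m]
  [MetricSpace X] [SecondCountableTopology X] [MeasurableSpace X] [BorelSpace X] {p : ℝ}

theorem lintegral_transportCost_lawKernel {f g : Ω × Y → X} (hf : Measurable f)
    (hg : Measurable g) :
    ∫⁻ ω, ∫⁻ z, edist z.1 z.2 ^ p ∂(lawKernel m (fun z => (f z, g z)) ω) ∂P =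
      ∫⁻ z, edist (f z) (g z) ^ p ∂(P.prod m) := by
  rw [lintegral_prod _ ((hf.edist hg).pow_const p).aemeasurable]
  exact lintegral_congr fun ω =>
    lintegral_lawKernel m (hf.prodMk hg) (measurable_edist_rpow p) ω

theorem kernelWasserstein_lawKernel_le (hp : 1 ≤ p) {f g : Ω × Y → X} (hf : Measurable f)
    (hg : Measurable g) :
    kernelWasserstein P p (lawKernel m f) (lawKernel m g) ≤ lpEDist p (P.prod m) f g := by
  rw [lpEDist, ← lintegral_transportCost_lawKernel m hf hg]
  exact ENNReal.rpow_le_rpow (iInf₂_le _ (lawKernel_prodMk_mem_kernelCouplings m hf hg))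
    (by positivity)

theorem lintegral_moment_lawKernel {f : Ω × Y → X} (hf : Measurable f) (x₀ : X) :
    ∫⁻ ω, ∫⁻ x, edist x x₀ ^ p ∂(lawKernel m f ω) ∂P =
      ∫⁻ z, edist (f z) x₀ ^ p ∂(P.prod m) := by
  rw [lintegral_prod _ ((hf.edist measurable_const).pow_const p).aemeasurable]
  exact lintegral_congr fun ω =>
    lintegral_lawKernel m hf ((measurable_id.edist measurable_const).pow_const p) ω

/-- The element of `K_p(X)` given by the laws of a function with finite `p`-th moment. -/
noncomputable def lawMomentKernel (hp : 1 ≤ p) {f : Ω × Y → X} (hf : Measurable f) {x₀ : X}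
    (h : lpEDist p (P.prod m) f (fun _ => x₀) < ∞) : MomentKernel P p X :=
  ⟨lawKernel m f, isMarkovKernel_lawKernel m hf, x₀, by
    rw [lintegral_moment_lawKernel m hf]
    exact (lpEDist_lt_top_iff hp _ _ _).1 h⟩

theorem MomentKernel.lpEDist_lt_top_of_lawKernel_eq (hp : 1 ≤ p) (μ : MomentKernel P p X)
    {f : Ω × Y → X} (hf : Measurable f) (h : lawKernel m f = μ.1) (x₀ : X) :
    lpEDist p (P.prod m) f (fun _ => x₀) < ∞ := by
  rw [lpEDist_lt_top_iff hp, ← lintegral_moment_lawKernel m hf, h]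
  have := μ.lintegral_lt_top hp x₀
  simpa only [rpow_lpEDist hp, id] using this

theorem separableSpace_kernelSpace [CompleteSpace X] [MeasureTheory.IsSeparable P] (hp : 1 ≤ p) :
    letI : MetricSpace (KernelSpace P p X) := kernelSpaceMetric hp
    TopologicalSpace.SeparableSpace (KernelSpace P p X) := by
  let : MetricSpace (KernelSpace P p X) := kernelSpaceMetric hp
  -- The moment condition provides a point of `X`, so for empty `X` the kernel space is empty.
  rcases isEmpty_or_nonempty X with hX | ⟨⟨x₀⟩⟩
  · have : IsEmpty (KernelSpace P p X) := ⟨by rintro ⟨μ⟩; exact hX.false μ.nonempty.some⟩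
    infer_instance
  have := isSeparable_prod P (volume : Measure unitInterval)
  obtain ⟨h, hh, hdense⟩ := exists_dense_seq_lpEDist (P.prod (volume : Measure unitInterval)) hp x₀
  refine ⟨Set.range fun i => KernelSpace.mk (lawMomentKernel volume hp (hh i).1 (hh i).2),
    Set.countable_range _, ?_⟩
  rintro ⟨μ⟩
  have := μ.isMarkovKernel
  have : Nonempty X := ⟨x₀⟩
  obtain ⟨F, hF, hFμ⟩ := Kernel.exists_measurable_map_eq_unitInterval μ.1
  have e : lawKernel volume (Function.uncurry F) = μ.1 := by
    ext ω : 1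
    rw [lawKernel_apply _ hF, ← hFμ]
    rfl
  refine EMetric.mem_closure_iff.2 fun ε hε => ?_
  obtain ⟨i, hi⟩ := hdense _ hF (μ.lpEDist_lt_top_of_lawKernel_eq volume hp hF e x₀) ε hε.ne'
  refine ⟨_, ⟨i, rfl⟩, lt_of_le_of_lt ?_ hi⟩
  refine (edist_kernelSpace_mk hp μ _).trans_le ?_
  rw [← e]
  exact kernelWasserstein_lawKernel_le volume hp hF (hh i).1

end LawKernelDist

/-! ### Realizing successive couplings by one driven chain -/

section CoupledSequence

variable {Ω X : Type*} [MeasurableSpace Ω] [MeasurableSpace X]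

/-- The law of a sequence of independent uniform variables. -/
noncomputable abbrev uniformSequence : Measure (ℕ → unitInterval) :=
  Measure.infinitePi fun _ => volume

/-- Successive transitions, driven by independent noise: `r` gives the first state and `g n` maps
the `n`-th state to the next one. -/
noncomputable def drivenChain (r : Ω → unitInterval → X) (g : ℕ → Ω × X → unitInterval → X) :
    ℕ → Ω × (ℕ → unitInterval) → X
  | 0 => fun z => r z.1 (z.2 0)
  | n + 1 => fun z => g n (z.1, drivenChain r g n z) (z.2 (n + 1))

variable {r : Ω → unitInterval → X} {g : ℕ → Ω × X → unitInterval → X}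

theorem measurable_drivenChain (hr : Measurable (Function.uncurry r))
    (hg : ∀ n, Measurable (Function.uncurry (g n))) (n : ℕ) : Measurable (drivenChain r g n) := by
  induction n with
  | zero =>
    exact hr.comp (measurable_fst.prodMk
      (by fun_prop : Measurable fun z : Ω × (ℕ → unitInterval) => z.2 0))
  | succ n ih =>
    exact (hg n).comp ((measurable_fst.prodMk ih).prodMk
      (by fun_prop : Measurable fun z : Ω × (ℕ → unitInterval) => z.2 (n + 1)))

/-- State `n` uses only the noise coordinates `0, …, n`. This makes coordinate `n + 1`, which drives
the next transition, independent of it. -/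
theorem exists_drivenChain_eq_comp_restrict (hr : Measurable (Function.uncurry r))
    (hg : ∀ n, Measurable (Function.uncurry (g n))) (n : ℕ) (ω : Ω) :
    ∃ G : (Finset.Iic n → unitInterval) → X, Measurable G ∧
      ∀ u, drivenChain r g n (ω, u) = G fun i => u i := by
  -- The noise is extended by the irrelevant value `0` beyond `n`.
  refine ⟨fun v => drivenChain r g n
    (ω, fun k => if h : k ∈ Finset.Iic n then v ⟨k, h⟩ else 0), ?_, fun u => ?_⟩
  · refine (measurable_drivenChain hr hg n).comp (measurable_const.prodMk ?_)
    refine measurable_pi_lambda _ fun k => ?_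
    by_cases h : k ∈ Finset.Iic n
    · simp only [h, dite_true]
      fun_prop
    · simp only [h, dite_false]
      fun_prop
  · have key : ∀ (k : ℕ) (u v : ℕ → unitInterval), (∀ i ≤ k, u i = v i) →
        drivenChain r g k (ω, u) = drivenChain r g k (ω, v) := by
      intro k
      induction k with
      | zero => intro u v h; simp only [drivenChain, h 0 le_rfl]
      | succ k ih =>
        intro u v h
        simp only [drivenChain, h (k + 1) le_rfl, ih u v fun i hi => h i (by omega)]
    refine key n _ _ fun i hi => ?_
    simp [hi]

theorem map_drivenChain_prodMk (hr : Measurable (Function.uncurry r))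
    (hg : ∀ n, Measurable (Function.uncurry (g n))) (n : ℕ) (ω : Ω) :
    uniformSequence.map (fun u => (drivenChain r g n (ω, u), u (n + 1))) =
      (uniformSequence.map fun u => drivenChain r g n (ω, u)).prod volume := by
  obtain ⟨G, hG, hGu⟩ := exists_drivenChain_eq_comp_restrict hr hg n ω
  have hind := (iIndepFun_infinitePi (P := fun _ : ℕ => (volume : Measure unitInterval))
    (X := fun _ x => x) fun _ => measurable_id).indepFun_finset (Finset.Iic n) {n + 1}
    (by simp) (fun i => by fun_prop)
  have hev : Measurable fun v : (({n + 1} : Finset ℕ) → unitInterval) =>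
      v ⟨n + 1, Finset.mem_singleton_self _⟩ := by fun_prop
  have h := (hind.comp hG hev).map_prod_eq_prod_map_map
    (hG.comp (by fun_prop)).aemeasurable (hev.comp (by fun_prop)).aemeasurable
  have h2 : uniformSequence.map (fun u => u (n + 1)) = volume :=
    Measure.infinitePi_map_eval (fun _ => volume) (n + 1)
  simp only [hGu]
  rw [← h2]
  exact h

/-- A sequence of successively coupled kernels can be realized by one sequence of functions. -/
theorem exists_lawKernel_sequence [StandardBorelSpace X] [Nonempty X]
    (μ : ℕ → Kernel Ω X) [∀ n, IsMarkovKernel (μ n)] (π : ℕ → Kernel Ω (X × X))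
    (hπ : ∀ n, π n ∈ kernelCouplings (μ n) (μ (n + 1))) :
    ∃ f : ℕ → Ω × (ℕ → unitInterval) → X, ∀ n, Measurable (f n) ∧
      lawKernel uniformSequence (f n) = μ n ∧
      lawKernel uniformSequence (fun z => (f n z, f (n + 1) z)) = π n := by
  have hπm : ∀ n, IsMarkovKernel (π n) := fun n => (hπ n).1
  obtain ⟨r, hr, hrμ⟩ := Kernel.exists_measurable_map_eq_unitInterval (μ 0)
  choose g hg hgκ using fun n => Kernel.exists_measurable_map_eq_unitInterval (π n).condKernel
  have hf := measurable_drivenChain hr hg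
  -- Since `g n` realizes the conditional kernel of `π n`, a state of law `μ n` and its successor
  -- have joint law `π n`. The law of the state is assumed here because `hlaw` obtains it by
  -- induction from this very step.
  have hpair : ∀ n, lawKernel uniformSequence (drivenChain r g n) = μ n →
      lawKernel uniformSequence (fun z => (drivenChain r g n z, drivenChain r g (n + 1) z)) =
        π n := by
    intro n hn
    have e : μ n ⊗ₖ (π n).condKernel = π n := by
      rw [← (hπ n).2.1]
      exact Kernel.disintegrate _ _
    rw [← e]
    ext ω s hs
    have hgω : Measurable fun z : X × unitInterval => (z.1, g n (ω, z.1) z.2) :=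
      measurable_fst.prodMk ((hg n).comp
        ((measurable_const.prodMk measurable_fst).prodMk measurable_snd))
    have h1 := map_drivenChain_prodMk hr hg n ω
    rw [← lawKernel_apply _ (hf n), hn] at h1
    rw [lawKernel_apply _ ((hf n).prodMk (hf (n + 1)))]
    have h2 : (fun u => (drivenChain r g n (ω, u), drivenChain r g (n + 1) (ω, u))) =
        (fun z : X × unitInterval => (z.1, g n (ω, z.1) z.2)) ∘
          fun u => (drivenChain r g n (ω, u), u (n + 1)) := rfl
    have hfω : Measurable fun u => (drivenChain r g n (ω, u), u (n + 1)) :=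
      ((hf n).comp measurable_prodMk_left).prodMk (measurable_pi_apply _)
    rw [h2, ← Measure.map_map hgω hfω, h1,
      Measure.map_apply hgω hs, Measure.prod_apply (hgω hs), Kernel.compProd_apply hs]
    refine lintegral_congr fun x => ?_
    have hgx : Measurable (g n (ω, x)) := (hg n).comp measurable_prodMk_left
    rw [← hgκ, Measure.map_apply hgx (measurable_prodMk_left hs)]
    rfl
  have hlaw : ∀ n, lawKernel uniformSequence (drivenChain r g n) = μ n := by
    intro n
    induction n with
    | zero =>
      ext ω : 1
      rw [lawKernel_apply _ (hf 0), ← hrμ,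
        ← Measure.infinitePi_map_eval (fun _ : ℕ => (volume : Measure unitInterval)) 0,
        Measure.map_map (show Measurable (r ω) from hr.comp measurable_prodMk_left) (by fun_prop)]
      rfl
    | succ n ih =>
      rw [← (hπ n).2.2, ← hpair n ih]
      exact (lawKernel_prodMk_mem_kernelCouplings _ (hf n) (hf (n + 1))).2.2.symm
  exact ⟨drivenChain r g, fun n => ⟨hf n, hlaw n, hpair n (hlaw n)⟩⟩

end CoupledSequence

/-! ### Completeness in `L^p` for metric-valued functions -/

section LpComplete

variable {Y X : Type*} [MeasurableSpace Y] (Q : Measure Y) [IsProbabilityMeasure Q]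
  [MetricSpace X] [SecondCountableTopology X] [MeasurableSpace X] [BorelSpace X] {p : ℝ}

theorem lintegral_edist_le_lpEDist (hp : 1 ≤ p) {f g : Y → X} (hf : Measurable f)
    (hg : Measurable g) : ∫⁻ y, edist (f y) (g y) ∂Q ≤ lpEDist p Q f g := by
  have h := eLpNorm'_le_eLpNorm'_of_exponent_le one_pos hp Q
    (hf.edist hg).aestronglyMeasurable
  simpa [eLpNorm', lpEDist] using h

theorem lpEDist_le_tsum (hp : 1 ≤ p) {f : ℕ → Y → X} (hf : ∀ n, Measurable (f n)) {B : ℕ → ℝ≥0∞}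
    (h : ∀ n, lpEDist p Q (f n) (f (n + 1)) ≤ B n) (n k : ℕ) :
    lpEDist p Q (f n) (f (k + n)) ≤ ∑' i, B (i + n) := by
  have hp0 : 0 < p := by linarith
  refine le_trans ?_ (ENNReal.sum_le_tsum (Finset.range k))
  induction k with
  | zero => simp [lpEDist, hp0]
  | succ k ih =>
    rw [Finset.sum_range_succ, Nat.succ_add]
    exact (lpEDist_triangle Q hp (hf n) (hf (k + n)) (hf _)).trans (add_le_add ih (h _))

/-- A sequence of functions with summable successive `L^p` distances converges in `L^p`. -/
theorem exists_tendsto_lpEDist [CompleteSpace X] [Nonempty X] (hp : 1 ≤ p) {f : ℕ → Y → X}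
    (hf : ∀ n, Measurable (f n)) {B : ℕ → ℝ≥0∞} (hB : ∑' n, B n ≠ ∞)
    (h : ∀ n, lpEDist p Q (f n) (f (n + 1)) ≤ B n) :
    ∃ F : Y → X, Measurable F ∧ ∀ n, lpEDist p Q (f n) F ≤ ∑' i, B (i + n) := by
  have hp0 : 0 < p := by linarith
  -- On a probability space the `L^1` distance is at most the `L^p` one, so the total length of the
  -- path `n ↦ f n y` is integrable and hence a.e. finite.
  have hsum : ∀ᵐ y ∂Q, ∑' n, edist (f n y) (f (n + 1) y) < ∞ := by
    refine ae_lt_top (Measurable.tsum fun n => (hf n).edist (hf (n + 1))) ?_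
    rw [lintegral_tsum fun n => ((hf n).edist (hf (n + 1))).aemeasurable]
    refine ne_top_of_le_ne_top hB (ENNReal.tsum_le_tsum fun n => ?_)
    exact (lintegral_edist_le_lpEDist Q hp (hf n) (hf (n + 1))).trans (h n)
  obtain ⟨F, hF, hlim⟩ := measurable_limit_of_tendsto_metrizable_ae (μ := Q) (L := Filter.atTop)
    (fun n => (hf n).aemeasurable) (by
      filter_upwards [hsum] with y hy
      exact cauchySeq_tendsto_of_complete
        (cauchySeq_of_edist_le_of_tsum_ne_top _ (fun n => le_rfl) hy.ne))
  refine ⟨F, hF, fun n => ?_⟩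
  rw [← ENNReal.rpow_le_rpow_iff hp0, rpow_lpEDist hp]
  -- Fatou's lemma transfers the tail bound from `f (k + n)` to the limit `F`.
  calc ∫⁻ y, edist (f n y) (F y) ^ p ∂Q
      = ∫⁻ y, Filter.liminf (fun k => edist (f n y) (f (k + n) y) ^ p) Filter.atTop ∂Q := by
        refine lintegral_congr_ae ?_
        filter_upwards [hlim] with y hy
        refine (Filter.Tendsto.liminf_eq ?_).symm
        exact ((ENNReal.continuous_rpow_const (y := p)).tendsto _).comp
          (tendsto_const_nhds.edist (hy.comp (Filter.tendsto_add_atTop_nat n)))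
    _ ≤ Filter.liminf (fun k => ∫⁻ y, edist (f n y) (f (k + n) y) ^ p ∂Q) Filter.atTop :=
        lintegral_liminf_le fun k => ((hf n).edist (hf (k + n))).pow_const p
    _ ≤ _ := by
        refine Filter.liminf_le_of_frequently_le' (Filter.Frequently.of_forall fun k => ?_)
        rw [← rpow_lpEDist hp]
        exact ENNReal.rpow_le_rpow (lpEDist_le_tsum Q hp hf h n k) hp0.le

end LpComplete

/-! ### Completeness of the kernel space -/

section Complete

variable {Ω X : Type*} [MeasurableSpace Ω] {P : Measure Ω} [IsProbabilityMeasure P]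
  [MetricSpace X] [SecondCountableTopology X] [CompleteSpace X] [MeasurableSpace X] [BorelSpace X]
  {p : ℝ}

theorem exists_kernelCouplings_lt (hp : 1 ≤ p) {μ ν : Kernel Ω X} {c : ℝ≥0∞}
    (h : kernelWasserstein P p μ ν < c) :
    ∃ π ∈ kernelCouplings μ ν, (∫⁻ ω, ∫⁻ z, edist z.1 z.2 ^ p ∂(π ω) ∂P) ^ (1 / p) < c := by
  have hp0 : 0 < p := by linarith
  rw [kernelWasserstein, one_div, ENNReal.rpow_inv_lt_iff hp0] at h
  simp only [iInf_lt_iff] at h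
  obtain ⟨π, hπ, hlt⟩ := h
  exact ⟨π, hπ, by rwa [one_div, ENNReal.rpow_inv_lt_iff hp0]⟩

theorem exists_tendsto_kernelWasserstein (hp : 1 ≤ p) (μ : ℕ → MomentKernel P p X)
    {B : ℕ → ℝ≥0∞} (hB : ∑' n, B n ≠ ∞)
    (h : ∀ n, kernelWasserstein P p (μ n).1 (μ (n + 1)).1 < B n) :
    ∃ ν : MomentKernel P p X, Filter.Tendsto (fun n => kernelWasserstein P p (μ n).1 ν.1)
      Filter.atTop (nhds 0) := by
  have := fun n => (μ n).isMarkovKernel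
  obtain ⟨x₀⟩ := (μ 0).nonempty
  have : Nonempty X := ⟨x₀⟩
  -- The strict inequality in `h` leaves room to pick couplings without knowing that the infimum is
  -- attained.
  choose π hπ hc using fun n => exists_kernelCouplings_lt hp (h n)
  obtain ⟨f, hf⟩ := exists_lawKernel_sequence (fun n => (μ n).1) π hπ
  obtain ⟨F, hF, hFB⟩ := exists_tendsto_lpEDist (P.prod uniformSequence) hp
    (fun n => (hf n).1) hB fun n => by
      rw [lpEDist, ← lintegral_transportCost_lawKernel _ (hf n).1 (hf (n + 1)).1, (hf n).2.2]
      exact (hc n).le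
  have hfin : lpEDist p (P.prod uniformSequence) F (fun _ => x₀) < ∞ := by
    refine (lpEDist_triangle _ hp hF (hf 0).1 measurable_const).trans_lt
      (ENNReal.add_lt_top.2 ⟨?_, ?_⟩)
    · rw [lpEDist_comm]
      exact (hFB 0).trans_lt (by simpa using hB.lt_top)
    · exact (μ 0).lpEDist_lt_top_of_lawKernel_eq _ hp (hf 0).1 (hf 0).2.1 x₀
  refine ⟨lawMomentKernel uniformSequence hp hF hfin, ?_⟩
  refine tendsto_of_tendsto_of_tendsto_of_le_of_le tendsto_const_nhds
    (ENNReal.tendsto_sum_nat_add B hB) (fun n => zero_le) fun n => ?_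
  refine le_trans ?_ (hFB n)
  rw [← (hf n).2.1]
  exact kernelWasserstein_lawKernel_le _ hp (hf n).1 hF

theorem completeSpace_kernelSpace (hp : 1 ≤ p) :
    letI : MetricSpace (KernelSpace P p X) := kernelSpaceMetric hp
    CompleteSpace (KernelSpace P p X) := by
  let : MetricSpace (KernelSpace P p X) := kernelSpaceMetric hp
  -- It suffices to treat sequences whose successive distances are below a summable geometric
  -- sequence.
  refine EMetric.complete_of_convergent_controlled_sequences (fun n => 2⁻¹ ^ n)
    (fun n => ENNReal.pow_pos (by simp) n) fun u hu => ?_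
  choose μ hμ using fun n => Quotient.exists_rep (u n)
  have hB : ∑' n : ℕ, (2⁻¹ : ℝ≥0∞) ^ n ≠ ∞ := by
    rw [ENNReal.tsum_geometric, ENNReal.one_sub_inv_two, inv_inv]
    exact ENNReal.ofNat_ne_top
  obtain ⟨ν, hν⟩ := exists_tendsto_kernelWasserstein hp μ hB fun n => by
    have := hu n n (n + 1) le_rfl (Nat.le_succ n)
    rwa [← hμ n, ← hμ (n + 1)] at this
  refine ⟨KernelSpace.mk ν, tendsto_iff_edist_tendsto_0.2 (hν.congr fun n => ?_)⟩
  rw [← hμ n]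
  rfl

end Complete

theorem theorem4p1 {Ω X : Type*} [MeasurableSpace Ω] (P : Measure Ω) [IsProbabilityMeasure P]
    [IsSeparable P] [MetricSpace X] [CompleteSpace X] [TopologicalSpace.SeparableSpace X]
    [MeasurableSpace X] [BorelSpace X] (p : ℝ) (hp : 1 ≤ p) :
    (∀ μ ν : MomentKernel P p X,
      AEMeasurable (fun ω => measureWasserstein p (μ.1 ω) (ν.1 ω)) P ∧
      kernelWasserstein P p μ.1 ν.1 =
        (∫⁻ ω, measureWasserstein p (μ.1 ω) (ν.1 ω) ^ p ∂P) ^ (1 / p)) ∧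
    ∃ _m : MetricSpace (KernelSpace P p X),
      (∀ μ ν : MomentKernel P p X,
        edist (KernelSpace.mk μ) (KernelSpace.mk ν) = kernelWasserstein P p μ.1 ν.1) ∧
      CompleteSpace (KernelSpace P p X) ∧
      TopologicalSpace.SeparableSpace (KernelSpace P p X) := by
  have : SecondCountableTopology X := UniformSpace.secondCountable_of_separable X
  exact ⟨fun μ ν => ⟨μ.aemeasurable_measureWasserstein hp ν, μ.kernelWasserstein_eq hp ν⟩,
    kernelSpaceMetric hp, fun μ ν => edist_kernelSpace_mk hp μ ν, completeSpace_kernelSpace hp,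
    separableSpace_kernelSpace hp⟩
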